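/- Let $m,n,\varrho,\xi$ be integers with $1\le\varrho\le m$ and $1\le\xi\le n$. Consider monomials in the variables $z_{i,j}$, $1\le i\le m$, $1\le j\le n$. For a monomial $f$ let $\mathscr I(f)$ be the set of pairs $(i,j)$ such that $z_{i,j}$ divides $f$. A set of pairs contains a $2$-chain (a $3$-chain) if it contains two pairs with $i_1<i_2$, $j_1<j_2$ (three pairs with $i_1<i_2<i_3$, $j_1<j_2<j_3$). For $r\ge 0$ let $P_1(m,n,\xi,r)$ be the number of monomials $f$ of degree $r$ such that $\mathscr I(f)$ contains no $3$-chain and $\{(i,j)\in\mathscr I(f): j<\xi\}$ contains no $2$-chain. Let $P_2(m,n,\varrho,\xi,r)$ be the number of monomials $f$ of degree $r$ such that every $(i,j)\in\mathscr I(f)$ satisfies $i\le\varrho$ or $j\ge\xi$, $\mathscr I(f)$ contains no $3$-chain, and neither $\{(i,j)\in\mathscr I(f): j<\xi\}$ nor $\{(i,j)\in\mathscr I(f): i>\varrho\}$ contains a $2$-chain. Then, for fixed $m,n,\varrho,\xi$, both $P_1(m,n,\xi,r)$ and $P_2(m,n,\varrho,\xi,r)$ are polynomial functions of $r\in\{0,1,2,\dots\}$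 with rational coefficients, and, writing $\mathrm{lc}_r$ and $\deg_r$ for the leading coefficient and the degree in $r$, $$\mathrm{lc}_r(P_1(m,n,\xi,r))\cdot(\deg_r P_1(m,n,\xi,r))!=\begin{cases}1,&\text{if } m=1\text{ or }n<3;\\[2pt] \frac{1}{n-1}\binom{m+n-4}{m-2}\binom{m+n-3}{n-2},&\text{if }\xi=1,\ m\ge2\text{ and }n\ge3;\\[2pt] \frac{\xi-1}{n-1}\binom{m+n-\xi-2}{m-2}\binom{m+n-3}{n-2},&\text{otherwise,}\end{cases}$$ and $$\mathrm{lc}_r(P_2(m,n,\varrho,\xi,r))\cdot(\deg_r P_2(m,n,\varrho,\xi,r))!=\begin{cases}1,&\text{if } m=1\text{ or }n=1;\\[2pt] \frac{1}{n-1}\binom{m+n-4}{m-2}\binom{m+n-3}{n-2},&\text{if }\varrho=m,\ \xi=1\text{ and }m,n>1;\\[2pt] \frac{(m-\varrho)(n-1)+(\varrho-1)(\xi-1)}{(m-1)(n-1)}\binom{m+n-\xi-2}{m-2}\binom{\varrho+n-3}{n-2},&\text{otherwise.}\end{cases}$$ -/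

import Mathlib

/-- A set of index pairs contains a 2-chain: two pairs strictly increasing in both entries. -/
def HasTwoChain (A : Set (ℕ × ℕ)) : Prop :=
  ∃ a ∈ A, ∃ b ∈ A, a.1 < b.1 ∧ a.2 < b.2

/-- A set of index pairs contains a 3-chain: three pairs strictly increasing in both entries. -/
def HasThreeChain (A : Set (ℕ × ℕ)) : Prop :=
  ∃ a ∈ A, ∃ b ∈ A, ∃ c ∈ A, (a.1 < b.1 ∧ a.2 < b.2) ∧ (b.1 < c.1 ∧ b.2 < c.2)

/-- Monomials of degree `r` in the variables `z_{i,j}`, `1 ≤ i ≤ m`, `1 ≤ j ≤ n`. The monomial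
`∏ z_{i,j} ^ γ (i, j)` is given by its exponent vector `γ`, and the set of index pairs of the
variables that occur in it is the support of `γ`. -/
def Monomials (m n r : ℕ) : Set (ℕ × ℕ →₀ ℕ) :=
  {γ | (∀ a ∈ γ.support, (1 ≤ a.1 ∧ a.1 ≤ m) ∧ (1 ≤ a.2 ∧ a.2 ≤ n)) ∧
    ∑ a ∈ γ.support, γ a = r}

/-- Monomials of degree `r` without 3-chains, and without 2-chains in columns `< ξ`. -/
def S1 (m n ξ r : ℕ) : Set (ℕ × ℕ →₀ ℕ) :=
  {γ | γ ∈ Monomials m n r ∧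
    ¬ HasThreeChain {a | a ∈ γ.support} ∧
    ¬ HasTwoChain {a | a ∈ γ.support ∧ a.2 < ξ}}

/-- Monomials of degree `r` in the variables `z_{i,j}` with `i ≤ ρ` or `j ≥ ξ`, without 3-chains,
without 2-chains in columns `< ξ`, and without 2-chains in rows `> ρ`. -/
def S2 (m n ρ ξ r : ℕ) : Set (ℕ × ℕ →₀ ℕ) :=
  {γ | γ ∈ Monomials m n r ∧
    (∀ a ∈ γ.support, a.1 ≤ ρ ∨ ξ ≤ a.2) ∧
    ¬ HasThreeChain {a | a ∈ γ.support} ∧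
    ¬ HasTwoChain {a | a ∈ γ.support ∧ a.2 < ξ} ∧
    ¬ HasTwoChain {a | a ∈ γ.support ∧ ρ < a.1}}

/-- There are finitely many monomials of given degree, so the cardinalities below are genuine. -/
theorem Monomials_finite (m n r : ℕ) : (Monomials m n r).Finite := by
  refine (Finset.finite_toSet
    ((Finset.Icc 1 m ×ˢ Finset.Icc 1 n).finsuppAntidiag r)).subset ?_
  rintro γ ⟨h1, h2⟩
  have hs : γ.support ⊆ Finset.Icc 1 m ×ˢ Finset.Icc 1 n := by
    intro a ha
    simpa [Finset.mem_product, Finset.mem_Icc] using h1 a ha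
  rw [Finset.mem_coe, Finset.mem_finsuppAntidiag]
  refine ⟨?_, hs⟩
  rw [← h2]
  exact (Finset.sum_subset hs (fun x _ hx => Finsupp.notMem_support_iff.mp hx)).symm

theorem S1_finite (m n ξ r : ℕ) : (S1 m n ξ r).Finite :=
  (Monomials_finite m n r).subset fun _ h => h.1

theorem S2_finite (m n ρ ξ r : ℕ) : (S2 m n ρ ξ r).Finite :=
  (Monomials_finite m n r).subset fun _ h => h.1

/-- The number of elements of `S1 m n ξ r`. -/
noncomputable def P1 (m n ξ r : ℕ) : ℕ := (S1 m n ξ r).ncard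

/-- The number of elements of `S2 m n ρ ξ r`. -/
noncomputable def P2 (m n ρ ξ r : ℕ) : ℕ := (S2 m n ρ ξ r).ncard

/-! The supports counted by `P2` are the faces of a simplicial complex. The corner `(1, n)` lies in
no 2-chain, so the complex is a cone over it. The monomials whose support without the corner is a
given set `F` number `r.choose F.card`. Summing over the faces that avoid the corner gives a
polynomial valid for every `r ≥ 0`, whose normalized leading coefficient is the number of faces of
maximal size (`exists_hilbertPolynomial`).

Those faces are counted by removing columns from the left. A pair `(a, b)`, initially `(ρ, m)`,
records what the removed columns still allow. A column `≥ ξ` lies in `[a', a] ∪ [b', b]` and leaves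
the pair `(a', b')`. A column `< ξ` lies in `[a', a]` and leaves `(a', b)`. Sizes telescope, and
since the final pair is at least `(1, 2)`, this yields the maximal size. Equality means that every
column fills its intervals, so faces of that size correspond to sequences of pairs with `a' ≤ a < b'
≤ b`. As for two nonintersecting lattice paths, their number is a 2×2 determinant of binomial
coefficients (`card_facesOfCard_left_add_two`), which simplifies to the stated product.

`P1` is the case `ρ = m`. If moreover `ξ = 1`, the telescoped bound is not attained, but then `ξ`
may be replaced by `2`. -/

/-- The supports of the monomials counted by `P2`, restricted to the columns `≥ s`, given that the
columns before `s` reach up to row `a` and that only rows `≤ b` are still available. -/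
structure IsFace (n ξ s a b : ℕ) (F : Finset (ℕ × ℕ)) : Prop where
  row : ∀ p ∈ F, 1 ≤ p.1 ∧ p.1 ≤ b
  col : ∀ p ∈ F, s ≤ p.2 ∧ p.2 ≤ n
  left : ∀ p ∈ F, p.1 ≤ a ∨ ξ ≤ p.2
  three : ∀ p ∈ F, ∀ q ∈ F, ∀ r ∈ F, p.1 < q.1 → p.2 < q.2 → q.1 < r.1 → q.2 < r.2 → False
  twoLeft : ∀ p ∈ F, ∀ q ∈ F, p.1 < q.1 → p.2 < q.2 → ξ ≤ q.2
  twoBelow : ∀ p ∈ F, ∀ q ∈ F, p.1 < q.1 → p.2 < q.2 → p.1 ≤ a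

/-! ### Splitting a set of pairs into one column and the rest -/

/-- The set with column `s` equal to `T` and remaining columns given by `F`. -/
def glueColumn (s : ℕ) (T : Finset ℕ) (F : Finset (ℕ × ℕ)) : Finset (ℕ × ℕ) :=
  T ×ˢ {s} ∪ F

/-- The rows of the points of `F` in column `s`. -/
def columnRows (s : ℕ) (F : Finset (ℕ × ℕ)) : Finset ℕ :=
  (F.filter (fun p => p.2 = s)).image Prod.fst

theorem mem_glueColumn {s : ℕ} {T : Finset ℕ} {F : Finset (ℕ × ℕ)} {p : ℕ × ℕ} :
    p ∈ glueColumn s T F ↔ (p.1 ∈ T ∧ p.2 = s) ∨ p ∈ F := by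
  rw [glueColumn, Finset.mem_union, Finset.mem_product, Finset.mem_singleton]

theorem mem_columnRows {s i : ℕ} {F : Finset (ℕ × ℕ)} : i ∈ columnRows s F ↔ (i, s) ∈ F := by
  simp [columnRows]

theorem glueColumn_columnRows (s : ℕ) (F : Finset (ℕ × ℕ)) :
    glueColumn s (columnRows s F) (F.filter (fun p => p.2 ≠ s)) = F := by
  ext ⟨i, j⟩
  simp only [mem_glueColumn, mem_columnRows, Finset.mem_filter]
  by_cases h : j = s
  · subst h; simp
  · simp [h]

theorem columnRows_glueColumn {s : ℕ} {T : Finset ℕ} {F : Finset (ℕ × ℕ)}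
    (hF : ∀ p ∈ F, s + 1 ≤ p.2) : columnRows s (glueColumn s T F) = T := by
  ext i
  simp only [mem_glueColumn, mem_columnRows]
  constructor
  · rintro (h | h)
    · exact h.1
    · have := hF _ h; simp at this
  · intro h; exact Or.inl ⟨h, trivial⟩

theorem filter_glueColumn {s : ℕ} {T : Finset ℕ} {F : Finset (ℕ × ℕ)}
    (hF : ∀ p ∈ F, s + 1 ≤ p.2) : (glueColumn s T F).filter (fun p => p.2 ≠ s) = F := by
  ext p
  simp only [mem_glueColumn, Finset.mem_filter]
  constructor
  · rintro ⟨h | h, h'⟩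
    · exact absurd h.2 h'
    · exact h
  · intro h
    have := hF _ h
    exact ⟨Or.inr h, by omega⟩

theorem card_glueColumn {s : ℕ} {T : Finset ℕ} {F : Finset (ℕ × ℕ)}
    (hF : ∀ p ∈ F, s + 1 ≤ p.2) : (glueColumn s T F).card = T.card + F.card := by
  rw [glueColumn, Finset.card_union_of_disjoint, Finset.card_product, Finset.card_singleton,
    mul_one]
  rw [Finset.disjoint_left]
  intro p hp hp'
  have := hF p hp'
  simp only [Finset.mem_product, Finset.mem_singleton] at hp
  omega

theorem card_eq_columnRows_add (s : ℕ) {F : Finset (ℕ × ℕ)} (hF : ∀ p ∈ F, s ≤ p.2) :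
    F.card = (columnRows s F).card + (F.filter (fun p => p.2 ≠ s)).card := by
  conv_lhs => rw [← glueColumn_columnRows s F]
  refine card_glueColumn fun p hp => ?_
  rw [Finset.mem_filter] at hp
  have := hF p hp.1
  omega

/-- The least element of `insert x S`, by its properties. -/
theorem exists_min_insert (x : ℕ) (S : Finset ℕ) :
    ∃ y, y ≤ x ∧ (y = x ∨ y ∈ S) ∧ ∀ z ∈ S, y ≤ z := by
  refine ⟨(insert x S).min' (Finset.insert_nonempty x S), Finset.min'_le _ _ (by simp), ?_, ?_⟩
  · simpa using Finset.min'_mem (insert x S) (Finset.insert_nonempty x S)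
  · intro z hz
    exact Finset.min'_le _ _ (by simp [hz])

/-! ### Removing and attaching the leftmost column of a face -/

section Peel

variable {n ξ s a b : ℕ} {F : Finset (ℕ × ℕ)}

/-- A later point below row `b'` would form a 2-chain starting in a row `> a`. A later 2-chain
starting below row `a'` would extend to a 3-chain through `(a', s)`. -/
theorem IsFace.peel (hs : ξ ≤ s) (ha : 1 ≤ a) (hab : a ≤ b) (hF : IsFace n ξ s a b F) :
    ∃ a' b', 1 ≤ a' ∧ a' ≤ a ∧ b' ≤ b ∧ (a < b' ∨ (a = b ∧ b' = b)) ∧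
      IsFace n ξ (s + 1) a' b' (F.filter (fun p => p.2 ≠ s)) ∧
      columnRows s F ⊆ Finset.Icc a' a ∪ Finset.Icc b' b := by
  -- The inserted elements `a` and `b` are the defaults when the column has no suitable point. They
  -- leave the constraint on later columns unchanged.
  obtain ⟨a', ha', ha'S, ha'm⟩ := exists_min_insert a (columnRows s F)
  obtain ⟨b', hb', hb'S, hb'm⟩ := exists_min_insert b ((columnRows s F).filter (fun i => a < i))
  simp only [Finset.mem_filter, mem_columnRows] at ha'S ha'm hb'S hb'm
  refine ⟨a', b', ?_, ha', hb', ?_, ⟨?_, ?_, ?_, ?_, ?_, ?_⟩, ?_⟩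
  · rcases ha'S with h | h
    · omega
    · exact (hF.row _ h).1
  · rcases hb'S with h | h
    · omega
    · exact Or.inl h.2
  · intro p hp
    rw [Finset.mem_filter] at hp
    have h1 := hF.row p hp.1
    have h2 := hF.col p hp.1
    refine ⟨h1.1, ?_⟩
    rcases hb'S with h | h
    · omega
    · by_contra hlt
      have := hF.twoBelow _ h.1 p hp.1 (by simpa using hlt) (by simp; omega)
      simp at this; omega
  · intro p hp
    rw [Finset.mem_filter] at hp
    have h2 := hF.col p hp.1
    omega
  · intro p hp
    rw [Finset.mem_filter] at hp
    have h2 := hF.col p hp.1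
    omega
  · intro p hp q hq r hr
    rw [Finset.mem_filter] at hp hq hr
    exact hF.three p hp.1 q hq.1 r hr.1
  · intro p hp q hq
    rw [Finset.mem_filter] at hp hq
    exact hF.twoLeft p hp.1 q hq.1
  · intro p hp q hq h1 h2
    rw [Finset.mem_filter] at hp hq
    have h3 := hF.col p hp.1
    rcases ha'S with h | h
    · rw [h]; exact hF.twoBelow p hp.1 q hq.1 h1 h2
    · by_contra hlt
      exact hF.three _ h p hp.1 q hq.1 (by simpa using hlt) (by simp; omega) h1 h2
  · intro i hi
    rw [mem_columnRows] at hi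
    have h1 := ha'm i hi
    have h2 := (hF.row _ hi).2
    simp only [Finset.mem_union, Finset.mem_Icc]
    by_cases h : i ≤ a
    · exact Or.inl ⟨h1, h⟩
    · exact Or.inr ⟨hb'm i ⟨hi, by omega⟩, h2⟩

/-- Later points have rows `≤ b'`, so only the part `[a', a]` of the new column can start a 2-chain.
Later 2-chains start in rows `≤ a'`, so no point of the new column precedes them. -/
theorem IsFace.glue {a' b' : ℕ} (hs : ξ ≤ s) (hsn : s ≤ n) (ha' : 1 ≤ a') (ha : a' ≤ a)
    (hb' : a < b') (hb : b' ≤ b) (hF : IsFace n ξ (s + 1) a' b' F) :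
    IsFace n ξ s a b (glueColumn s (Finset.Icc a' a ∪ Finset.Icc b' b) F) := by
  refine ⟨?_, ?_, ?_, ?_, ?_, ?_⟩
  · intro p hp
    rw [mem_glueColumn, Finset.mem_union, Finset.mem_Icc, Finset.mem_Icc] at hp
    rcases hp with hp | hp
    · omega
    · have := hF.row p hp
      omega
  · intro p hp
    rw [mem_glueColumn] at hp
    rcases hp with hp | hp
    · omega
    · have := hF.col p hp
      omega
  · intro p hp
    rw [mem_glueColumn] at hp
    rcases hp with hp | hp
    · omega
    · have := hF.col p hp
      omega
  · intro p hp q hq r hr h1 h2 h3 h4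
    rw [mem_glueColumn, Finset.mem_union, Finset.mem_Icc, Finset.mem_Icc] at hp hq hr
    have hs' : s ≤ p.2 := by
      rcases hp with hp | hp
      · omega
      · have := hF.col p hp; omega
    have hq : q ∈ F := hq.resolve_left (by omega)
    have hr : r ∈ F := hr.resolve_left (by omega)
    rcases hp with hp | hp
    · have := hF.twoBelow q hq r hr h3 h4
      omega
    · exact hF.three p hp q hq r hr h1 h2 h3 h4
  · intro p hp q hq h1 h2
    rw [mem_glueColumn] at hq
    rcases hq with hq | hq
    · omega
    · have := hF.col q hq; omega
  · intro p hp q hq h1 h2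
    rw [mem_glueColumn, Finset.mem_union, Finset.mem_Icc, Finset.mem_Icc] at hp hq
    have hs' : s ≤ p.2 := by
      rcases hp with hp | hp
      · omega
      · have := hF.col p hp; omega
    have hq : q ∈ F := hq.resolve_left (by omega)
    rcases hp with hp | hp
    · have := hF.row q hq
      omega
    · have := hF.twoBelow p hp q hq h1 h2
      omega

/-- Before column `ξ`, the points of the column already lie in rows `≤ a`, so `b` does not change. A
later point in a column `< ξ` and below row `a'` would form a forbidden 2-chain with `(a', s)`. -/
theorem IsFace.peel_left (hs : s < ξ) (ha : 1 ≤ a) (hF : IsFace n ξ s a b F) :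
    ∃ a', 1 ≤ a' ∧ a' ≤ a ∧ IsFace n ξ (s + 1) a' b (F.filter (fun p => p.2 ≠ s)) ∧
      columnRows s F ⊆ Finset.Icc a' a := by
  obtain ⟨a', ha', ha'S, ha'm⟩ := exists_min_insert a (columnRows s F)
  simp only [mem_columnRows] at ha'S ha'm
  refine ⟨a', ?_, ha', ⟨?_, ?_, ?_, ?_, ?_, ?_⟩, ?_⟩
  · rcases ha'S with h | h
    · omega
    · exact (hF.row _ h).1
  · intro p hp
    rw [Finset.mem_filter] at hp
    exact hF.row p hp.1
  · intro p hp
    rw [Finset.mem_filter] at hp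
    have h2 := hF.col p hp.1
    omega
  · intro p hp
    rw [Finset.mem_filter] at hp
    have h2 := hF.col p hp.1
    rcases ha'S with h | h
    · rw [h]; exact hF.left p hp.1
    · by_contra! hlt
      have := hF.twoLeft _ h p hp.1 (by simpa using hlt.1) (by simp; omega)
      omega
  · intro p hp q hq r hr
    rw [Finset.mem_filter] at hp hq hr
    exact hF.three p hp.1 q hq.1 r hr.1
  · intro p hp q hq
    rw [Finset.mem_filter] at hp hq
    exact hF.twoLeft p hp.1 q hq.1
  · intro p hp q hq h1 h2
    rw [Finset.mem_filter] at hp hq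
    have h3 := hF.col p hp.1
    rcases ha'S with h | h
    · rw [h]; exact hF.twoBelow p hp.1 q hq.1 h1 h2
    · by_contra hlt
      exact hF.three _ h p hp.1 q hq.1 (by simpa using hlt) (by simp; omega) h1 h2
  · intro i hi
    rw [mem_columnRows] at hi
    rw [Finset.mem_Icc]
    have := hF.left _ hi
    simp only at this
    exact ⟨ha'm i hi, by omega⟩

theorem IsFace.glue_left {a' : ℕ} (hsn : s ≤ n) (ha' : 1 ≤ a') (ha : a' ≤ a)
    (hab : a ≤ b) (hF : IsFace n ξ (s + 1) a' b F) :
    IsFace n ξ s a b (glueColumn s (Finset.Icc a' a) F) := by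
  refine ⟨?_, ?_, ?_, ?_, ?_, ?_⟩
  · intro p hp
    rw [mem_glueColumn, Finset.mem_Icc] at hp
    rcases hp with hp | hp
    · omega
    · exact hF.row p hp
  · intro p hp
    rw [mem_glueColumn] at hp
    rcases hp with hp | hp
    · omega
    · have := hF.col p hp
      omega
  · intro p hp
    rw [mem_glueColumn, Finset.mem_Icc] at hp
    rcases hp with hp | hp
    · omega
    · have := hF.left p hp
      omega
  · intro p hp q hq r hr h1 h2 h3 h4
    rw [mem_glueColumn, Finset.mem_Icc] at hp hq hr
    have hs' : s ≤ p.2 := by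
      rcases hp with hp | hp
      · omega
      · have := hF.col p hp; omega
    have hq : q ∈ F := hq.resolve_left (by omega)
    have hr : r ∈ F := hr.resolve_left (by omega)
    rcases hp with hp | hp
    · have := hF.twoBelow q hq r hr h3 h4
      omega
    · exact hF.three p hp q hq r hr h1 h2 h3 h4
  · intro p hp q hq h1 h2
    rw [mem_glueColumn, Finset.mem_Icc] at hp hq
    have hs' : s ≤ p.2 := by
      rcases hp with hp | hp
      · omega
      · have := hF.col p hp; omega
    have hq : q ∈ F := hq.resolve_left (by omega)
    rcases hp with hp | hp
    · have := hF.left q hq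
      omega
    · exact hF.twoLeft p hp q hq h1 h2
  · intro p hp q hq h1 h2
    rw [mem_glueColumn, Finset.mem_Icc] at hp hq
    have hs' : s ≤ p.2 := by
      rcases hp with hp | hp
      · omega
      · have := hF.col p hp; omega
    have hq : q ∈ F := hq.resolve_left (by omega)
    rcases hp with hp | hp
    · omega
    · have := hF.twoBelow p hp q hq h1 h2
      omega

theorem IsFace.eq_empty (hs : n < s) (hF : IsFace n ξ s a b F) : F = ∅ := by
  rw [Finset.eq_empty_iff_forall_notMem]
  intro p hp
  have := hF.col p hp
  omega

theorem isFace_empty (n ξ s a b : ℕ) : IsFace n ξ s a b ∅ := by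
  constructor <;> simp

end Peel

/-! ### The maximal size of a face -/

theorem card_Icc_union_Icc_le {a a' b b' : ℕ} (h : a' ≤ a) (hb : b' ≤ b)
    {S : Finset ℕ} (hS : S ⊆ Finset.Icc a' a ∪ Finset.Icc b' b) :
    S.card + a' + b' ≤ a + b + 2 := by
  have h1 := Finset.card_le_card hS
  have h2 := Finset.card_union_le (Finset.Icc a' a) (Finset.Icc b' b)
  rw [Nat.card_Icc, Nat.card_Icc] at h2
  omega

theorem card_Icc_union_Icc {a a' b b' : ℕ} (h : a < b') :
    (Finset.Icc a' a ∪ Finset.Icc b' b).card = (a + 1 - a') + (b + 1 - b') := by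
  rw [Finset.card_union_of_disjoint, Nat.card_Icc, Nat.card_Icc]
  rw [Finset.disjoint_left]
  intro x hx hx'
  rw [Finset.mem_Icc] at hx hx'
  omega

/-- Bound for the size of a face when all columns are `≥ ξ`. -/
theorem IsFace.card_le {n ξ : ℕ} (t : ℕ) : ∀ {s a b : ℕ} {F : Finset (ℕ × ℕ)}, s + t = n + 1 →
    ξ ≤ s → 1 ≤ a → a ≤ b → 2 ≤ b → IsFace n ξ s a b F → F.card + 3 ≤ 2 * t + a + b := by
  induction t with
  | zero =>
    intro s a b F hs _ ha hab hb hF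
    -- The constant `3` is the least possible value `1 + 2` of `a + b` when no columns remain.
    rw [hF.eq_empty (by omega)]
    simp; omega
  | succ t ih =>
    intro s a b F hs hξ ha hab hb hF
    obtain ⟨a', b', h1, h2, h3, h4, h5, h6⟩ := hF.peel hξ ha hab
    have h7 := ih (by omega) (by omega) h1 (by omega) (by omega) h5
    have h8 := card_Icc_union_Icc_le h2 h3 h6
    have h9 := card_eq_columnRows_add s (fun p hp => (hF.col p hp).1)
    omega

/-- A column before `ξ` moves only `a`, so it contributes `1` to the telescoping sum where a column
from `ξ` on contributes `2`. -/
theorem IsFace.card_le_left {n ξ k : ℕ} (hk : ξ + k = n + 1) (u : ℕ) :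
    ∀ {s a b : ℕ} {F : Finset (ℕ × ℕ)}, s + u = ξ →
    1 ≤ a → a ≤ b → 2 ≤ b → IsFace n ξ s a b F → F.card + 3 ≤ 2 * k + u + a + b := by
  induction u with
  | zero =>
    intro s a b F hs ha hab hb hF
    exact hF.card_le k (by omega) (by omega) ha hab hb
  | succ u ih =>
    intro s a b F hs ha hab hb hF
    obtain ⟨a', h1, h2, h5, h6⟩ := hF.peel_left (by omega) ha
    have h7 := ih (by omega) h1 (by omega) hb h5
    have h8 := Finset.card_le_card h6
    rw [Nat.card_Icc] at h8
    have h9 := card_eq_columnRows_add s (fun p hp => (hF.col p hp).1)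
    omega

/-! ### Recursions for the number of faces of maximal size -/

open Classical in
/-- The faces with exactly `N` elements. -/
noncomputable def facesOfCard (n ξ s a b N : ℕ) : Finset (Finset (ℕ × ℕ)) :=
  (Finset.Icc 1 b ×ˢ Finset.Icc s n).powerset.filter (fun F => IsFace n ξ s a b F ∧ F.card = N)

theorem mem_facesOfCard {n ξ s a b N : ℕ} {F : Finset (ℕ × ℕ)} :
    F ∈ facesOfCard n ξ s a b N ↔ IsFace n ξ s a b F ∧ F.card = N := by
  simp only [facesOfCard, Finset.mem_filter, Finset.mem_powerset, and_iff_right_iff_imp]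
  rintro ⟨hF, -⟩ p hp
  simp only [Finset.mem_product, Finset.mem_Icc]
  exact ⟨hF.row p hp, hF.col p hp⟩

theorem Icc_union_Icc_inj {a b x x' y y' : ℕ} (hx : x ≤ a) (hy : a < y) (hyb : y ≤ b)
    (hx' : x' ≤ a) (hy' : a < y') (hyb' : y' ≤ b)
    (h : Finset.Icc x a ∪ Finset.Icc y b = Finset.Icc x' a ∪ Finset.Icc y' b) :
    x = x' ∧ y = y' := by
  simp only [Finset.ext_iff, Finset.mem_union, Finset.mem_Icc] at h
  have h1 := (h x).1 (by omega)
  have h2 := (h x').2 (by omega)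
  have h3 := (h y).1 (by omega)
  have h4 := (h y').2 (by omega)
  omega

/-- `N` is the bound of `IsFace.card_le`. Attaining it forces the column to fill both intervals and
the rest to be maximal for `(x, y)`; the column then determines `x` and `y`. -/
theorem card_facesOfCard_succ {n ξ s t a b N : ℕ} (hs : s + t = n) (hξ : ξ ≤ s) (ha : 1 ≤ a)
    (hab : a ≤ b) (hb : 2 ≤ b) (hN : N + 3 = 2 * (t + 1) + a + b) :
    (facesOfCard n ξ s a b N).card = ∑ x ∈ Finset.Icc 1 a, ∑ y ∈ Finset.Ioc a b,
      (facesOfCard n ξ (s + 1) x y (2 * t + x + y - 3)).card := by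
  classical
  rw [← Finset.sum_product' (Finset.Icc 1 a) (Finset.Ioc a b)
    (fun x y => (facesOfCard n ξ (s + 1) x y (2 * t + x + y - 3)).card), ← Finset.card_sigma]
  symm
  refine Finset.card_nbij (fun z => glueColumn s (Finset.Icc z.1.1 a ∪ Finset.Icc z.1.2 b) z.2)
    ?_ ?_ ?_
  · rintro ⟨⟨x, y⟩, F⟩ hz
    simp only [Finset.coe_sigma, Set.mem_sigma_iff, Finset.mem_coe, Finset.mem_product,
      Finset.mem_Icc, Finset.mem_Ioc, mem_facesOfCard] at hz
    obtain ⟨⟨⟨hx1, hxa⟩, hay, hyb⟩, hF, hc⟩ := hz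
    rw [Finset.mem_coe, mem_facesOfCard]
    refine ⟨hF.glue hξ (by omega) hx1 hxa hay hyb, ?_⟩
    dsimp only
    rw [card_glueColumn fun p hp => (hF.col p hp).1, card_Icc_union_Icc hay]
    omega
  · rintro ⟨⟨x, y⟩, F⟩ hz ⟨⟨x', y'⟩, F'⟩ hz' h
    simp only [Finset.coe_sigma, Set.mem_sigma_iff, Finset.mem_coe, Finset.mem_product,
      Finset.mem_Icc, Finset.mem_Ioc, mem_facesOfCard] at hz hz'
    have hc : ∀ p ∈ F, s + 1 ≤ p.2 := fun p hp => (hz.2.1.col p hp).1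
    have hc' : ∀ p ∈ F', s + 1 ≤ p.2 := fun p hp => (hz'.2.1.col p hp).1
    have h1 := congrArg (columnRows s) h
    have h2 := congrArg (Finset.filter (fun p => p.2 ≠ s)) h
    simp only at h1 h2
    rw [columnRows_glueColumn hc, columnRows_glueColumn hc'] at h1
    rw [filter_glueColumn hc, filter_glueColumn hc'] at h2
    obtain ⟨rfl, rfl⟩ := Icc_union_Icc_inj hz.1.1.2 hz.1.2.1 hz.1.2.2 hz'.1.1.2 hz'.1.2.1
      hz'.1.2.2 h1
    rw [h2]
  · intro F hF
    rw [Finset.mem_coe, mem_facesOfCard] at hF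
    obtain ⟨hF, hc⟩ := hF
    obtain ⟨a', b', h1, h2, h3, h4, h5, h6⟩ := hF.peel hξ ha hab
    have h7 := h5.card_le t (by omega) (by omega) h1 (by omega) (by omega)
    have h8 := card_Icc_union_Icc_le h2 h3 h6
    have h9 := card_eq_columnRows_add s (fun p hp => (hF.col p hp).1)
    -- If `a = b = b'`, the two intervals overlap in row `b`, and the face falls one short of the
    -- bound.
    have h10 : a < b' := by
      rcases h4 with h4 | ⟨rfl, rfl⟩
      · exact h4
      · have := Finset.card_le_card (h6.trans (Finset.union_subset subset_rfl
          (Finset.Icc_subset_Icc_left h2)))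
        rw [Nat.card_Icc] at this
        omega
    have h11 := card_Icc_union_Icc (a' := a') (b := b) h10
    have h12 := Finset.eq_of_subset_of_card_le h6 (by omega)
    refine ⟨⟨(a', b'), F.filter (fun p => p.2 ≠ s)⟩, ?_, ?_⟩
    · simp only [Finset.coe_sigma, Set.mem_sigma_iff, Finset.mem_coe, Finset.mem_product,
        Finset.mem_Icc, Finset.mem_Ioc, mem_facesOfCard]
      exact ⟨⟨⟨h1, h2⟩, h10, h3⟩, h5, by omega⟩
    · simp only
      rw [← h12, glueColumn_columnRows]

/-- The same equality argument, with a single interval for the column and `b` fixed. -/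
theorem card_facesOfCard_left_succ {n ξ k s u a b N : ℕ} (hk : ξ + k = n + 1) (hk1 : 1 ≤ k)
    (hs : s + (u + 1) = ξ)
    (ha : 1 ≤ a) (hab : a ≤ b) (hb : 2 ≤ b) (hN : N + 3 = 2 * k + (u + 1) + a + b) :
    (facesOfCard n ξ s a b N).card = ∑ x ∈ Finset.Icc 1 a,
      (facesOfCard n ξ (s + 1) x b (2 * k + u + x + b - 3)).card := by
  classical
  rw [← Finset.card_sigma]
  symm
  refine Finset.card_nbij (fun z => glueColumn s (Finset.Icc z.1 a) z.2) ?_ ?_ ?_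
  · rintro ⟨x, F⟩ hz
    simp only [Finset.coe_sigma, Set.mem_sigma_iff, Finset.mem_coe, Finset.mem_Icc,
      mem_facesOfCard] at hz
    obtain ⟨⟨hx1, hxa⟩, hF, hc⟩ := hz
    rw [Finset.mem_coe, mem_facesOfCard]
    refine ⟨hF.glue_left (by omega) hx1 hxa hab, ?_⟩
    dsimp only
    rw [card_glueColumn fun p hp => (hF.col p hp).1, Nat.card_Icc]
    omega
  · rintro ⟨x, F⟩ hz ⟨x', F'⟩ hz' h
    simp only [Finset.coe_sigma, Set.mem_sigma_iff, Finset.mem_coe,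
      Finset.mem_Icc, mem_facesOfCard] at hz hz'
    have hc : ∀ p ∈ F, s + 1 ≤ p.2 := fun p hp => (hz.2.1.col p hp).1
    have hc' : ∀ p ∈ F', s + 1 ≤ p.2 := fun p hp => (hz'.2.1.col p hp).1
    have h1 := congrArg (columnRows s) h
    have h2 := congrArg (Finset.filter (fun p => p.2 ≠ s)) h
    simp only at h1 h2
    rw [columnRows_glueColumn hc, columnRows_glueColumn hc'] at h1
    rw [filter_glueColumn hc, filter_glueColumn hc'] at h2
    have h3 : x = x' := by
      simp only [Finset.ext_iff, Finset.mem_Icc] at h1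
      have h3 := (h1 x).1 (by omega)
      have h4 := (h1 x').2 (by omega)
      omega
    subst h3
    rw [h2]
  · intro F hF
    rw [Finset.mem_coe, mem_facesOfCard] at hF
    obtain ⟨hF, hc⟩ := hF
    obtain ⟨a', h1, h2, h5, h6⟩ := hF.peel_left (by omega) ha
    have h7 := h5.card_le_left hk u (by omega) h1 (by omega) hb
    have h8 := Finset.card_le_card h6
    rw [Nat.card_Icc] at h8
    have h9 := card_eq_columnRows_add s (fun p hp => (hF.col p hp).1)
    have h12 := Finset.eq_of_subset_of_card_le h6 (by rw [Nat.card_Icc]; omega)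
    refine ⟨⟨a', F.filter (fun p => p.2 ≠ s)⟩, ?_, ?_⟩
    · simp only [Finset.coe_sigma, Set.mem_sigma_iff, Finset.mem_coe,
        Finset.mem_Icc, mem_facesOfCard]
      exact ⟨⟨h1, h2⟩, h5, by omega⟩
    · simp only
      rw [← h12, glueColumn_columnRows]

/-! ### Solving the recursions by binomial determinants -/

/-- Summation of binomial coefficients along a diagonal. -/
theorem sum_choose_diag (i : ℕ) (X : ℕ) (c : ℕ) :
    ∑ x ∈ Finset.Icc 1 X, ((x - 1 + i).choose (i + c) : ℤ) = ((X + i).choose (i + 1 + c) : ℤ) := by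
  induction X with
  | zero =>
    rw [Nat.choose_eq_zero_of_lt (by omega)]
    simp
  | succ X ih =>
    rw [Finset.sum_Icc_succ_top (by omega), ih, Nat.add_sub_cancel,
      show X + 1 + i = (X + i) + 1 by ring, show i + 1 + c = (i + c) + 1 by ring,
      Nat.choose_succ_succ]
    push_cast; ring

theorem sum_Ioc_eq_sub (f : ℕ → ℤ) {a b : ℕ} (h : a ≤ b) :
    ∑ y ∈ Finset.Ioc a b, f y = ∑ y ∈ Finset.Icc 1 b, f y - ∑ y ∈ Finset.Icc 1 a, f y := by
  induction b, h using Nat.le_induction with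
  | base => simp
  | succ b hb ih =>
    rw [Finset.sum_Ioc_succ_top (by omega), ih, Finset.sum_Icc_succ_top (by omega)]
    ring

/-- Only the empty face remains, and it is maximal exactly when `a + b = 3`. The subtraction does
not truncate, since `a ≥ 1` and `b ≥ 2`. -/
theorem card_facesOfCard_zero {n ξ s a b N : ℕ} (hs : s = n + 1) (ha : 1 ≤ a) (hb : 2 ≤ b)
    (hN : N = a + b - 3) :
    (facesOfCard n ξ s a b N).card = if a = 1 ∧ b = 2 then 1 else 0 := by
  split_ifs with h
  · rw [Finset.card_eq_one]
    refine ⟨∅, ?_⟩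
    ext F
    rw [mem_facesOfCard, Finset.mem_singleton]
    constructor
    · exact fun hF => hF.1.eq_empty (by omega)
    · rintro rfl
      exact ⟨isFace_empty _ _ _ _ _, by simp; omega⟩
  · rw [Finset.card_eq_zero, Finset.eq_empty_iff_forall_notMem]
    intro F hF
    rw [mem_facesOfCard] at hF
    have := hF.1.eq_empty (by omega)
    rw [this] at hF
    have := hF.2
    simp at this
    omega

/-- The next pair must be `(1, 2)`, and `2` lies in `(a, b]` only for `a = 1`. -/
theorem card_facesOfCard_one {n ξ s a b N : ℕ} (hs : s = n) (hξ : ξ ≤ s) (ha : 1 ≤ a)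
    (hab : a ≤ b) (hb : 2 ≤ b) (hN : N = a + b - 1) :
    (facesOfCard n ξ s a b N).card = if a = 1 then 1 else 0 := by
  rw [card_facesOfCard_succ (t := 0) (by omega) hξ ha hab hb (by omega)]
  have h : ∀ x ∈ Finset.Icc 1 a, ∀ y ∈ Finset.Ioc a b,
      (facesOfCard n ξ (s + 1) x y (2 * 0 + x + y - 3)).card =
        if x = 1 ∧ y = 2 then 1 else 0 := by
    intro x hx y hy
    rw [Finset.mem_Icc] at hx
    rw [Finset.mem_Ioc] at hy
    exact card_facesOfCard_zero (by omega) (by omega) (by omega) (by omega)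
  rw [Finset.sum_congr rfl fun x hx => Finset.sum_congr rfl (h x hx)]
  split_ifs with h1
  · subst h1
    rw [Finset.Icc_self, Finset.sum_singleton]
    simp [Finset.mem_Ioc, hb]
  · refine Finset.sum_eq_zero fun x hx => Finset.sum_eq_zero fun y hy => ?_
    rw [Finset.mem_Icc] at hx
    rw [Finset.mem_Ioc] at hy
    rw [if_neg (by omega)]

/-- The determinant shape survives the recursion: a sum over `(a, b]` is the sum over `[1, b]` minus
that over `[1, a]`, and the products of two sums over `[1, a]` cancel. The formula starts at two
columns, where the count is `b - a`. -/
theorem card_facesOfCard_add_two {n ξ : ℕ} (i : ℕ) : ∀ {s a b N : ℕ}, s + i + 1 = n → ξ ≤ s →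
    1 ≤ a → a ≤ b → 2 ≤ b → N = 2 * (i + 2) + a + b - 3 →
    ((facesOfCard n ξ s a b N).card : ℤ) =
      ((a - 1 + i).choose i : ℤ) * ((b - 1 + i).choose (i + 1) : ℤ) -
        ((a - 1 + i).choose (i + 1) : ℤ) * ((b - 1 + i).choose i : ℤ) := by
  induction i with
  | zero =>
    intro s a b N hs hξ ha hab hb hN
    rw [card_facesOfCard_succ (t := 1) (by omega) hξ ha hab hb (by omega)]
    have h : ∀ x ∈ Finset.Icc 1 a, ∀ y ∈ Finset.Ioc a b,
        (facesOfCard n ξ (s + 1) x y (2 * 1 + x + y - 3)).card = if x = 1 then 1 else 0 := by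
      intro x hx y hy
      rw [Finset.mem_Icc] at hx
      rw [Finset.mem_Ioc] at hy
      exact card_facesOfCard_one (by omega) (by omega) (by omega) (by omega) (by omega) (by omega)
    rw [Finset.sum_congr rfl fun x hx => Finset.sum_congr rfl (h x hx)]
    simp [ha]
    omega
  | succ i ih =>
    intro s a b N hs hξ ha hab hb hN
    rw [card_facesOfCard_succ (t := i + 2) (by omega) hξ ha hab hb (by omega)]
    push_cast
    have h : ∀ x ∈ Finset.Icc 1 a, ∀ y ∈ Finset.Ioc a b,
        ((facesOfCard n ξ (s + 1) x y (2 * (i + 2) + x + y - 3)).card : ℤ) =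
          ((x - 1 + i).choose i : ℤ) * ((y - 1 + i).choose (i + 1) : ℤ) -
        ((x - 1 + i).choose (i + 1) : ℤ) * ((y - 1 + i).choose i : ℤ) := by
      intro x hx y hy
      rw [Finset.mem_Icc] at hx
      rw [Finset.mem_Ioc] at hy
      exact ih (by omega) (by omega) (by omega) (by omega) (by omega) (by omega)
    rw [Finset.sum_congr rfl fun x hx => Finset.sum_congr rfl (h x hx)]
    simp only [Finset.sum_sub_distrib, ← Finset.mul_sum, ← Finset.sum_mul]
    have e0 := fun X => sum_choose_diag i X 0
    have e1 := fun X => sum_choose_diag i X 1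
    simp only [add_zero] at e0 e1
    rw [sum_Ioc_eq_sub _ hab, sum_Ioc_eq_sub _ hab, e0, e1, e0, e1,
      show a - 1 + (i + 1) = a + i by omega, show b - 1 + (i + 1) = b + i by omega]
    ring

/-- Each column before `ξ` sums over `a` only, so it raises the indices in the binomials containing
`a` and leaves those containing `b` alone. -/
theorem card_facesOfCard_left_add_two {n ξ i : ℕ} (hi : ξ + i + 1 = n) (u : ℕ) :
    ∀ {s a b N : ℕ}, s + u = ξ →
    1 ≤ a → a ≤ b → 2 ≤ b → N = 2 * (i + 2) + u + a + b - 3 →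
    ((facesOfCard n ξ s a b N).card : ℤ) =
      ((a - 1 + (i + u)).choose (i + u) : ℤ) * ((b - 1 + i).choose (i + 1) : ℤ) -
        ((a - 1 + (i + u)).choose (i + u + 1) : ℤ) * ((b - 1 + i).choose i : ℤ) := by
  induction u with
  | zero =>
    intro s a b N hs ha hab hb hN
    exact card_facesOfCard_add_two i (by omega) (by omega) ha hab hb (by omega)
  | succ u ih =>
    intro s a b N hs ha hab hb hN
    rw [card_facesOfCard_left_succ (k := i + 2) (u := u) (by omega) (by omega) hs ha hab hb
      (by omega)]
    push_cast
    have h : ∀ x ∈ Finset.Icc 1 a,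
        ((facesOfCard n ξ (s + 1) x b (2 * (i + 2) + u + x + b - 3)).card : ℤ) =
          ((x - 1 + (i + u)).choose (i + u) : ℤ) * ((b - 1 + i).choose (i + 1) : ℤ) -
        ((x - 1 + (i + u)).choose (i + u + 1) : ℤ) * ((b - 1 + i).choose i : ℤ) := by
      intro x hx
      rw [Finset.mem_Icc] at hx
      exact ih (by omega) (by omega) (by omega) (by omega) (by omega)
    rw [Finset.sum_congr rfl h]
    simp only [Finset.sum_sub_distrib, ← Finset.sum_mul]
    have e0 := fun X => sum_choose_diag (i + u) X 0
    have e1 := fun X => sum_choose_diag (i + u) X 1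
    simp only [add_zero] at e0 e1
    rw [e0, e1, show a - 1 + (i + (u + 1)) = a + (i + u) by omega]
    rfl

/-- For `ξ = n` there is just one column with two intervals, too few for the determinant formula. It
forces the first entry to be `1` when it is reached, and one binomial sum is left. -/
theorem card_facesOfCard_left_last {n ξ : ℕ} (hi : ξ = n) (u : ℕ) :
    ∀ {s a b N : ℕ}, s + (u + 1) = ξ →
    1 ≤ a → a ≤ b → 2 ≤ b → N = u + a + b →
    ((facesOfCard n ξ s a b N).card : ℤ) = ((a - 1 + u).choose u : ℤ) := by
  induction u with
  | zero =>
    intro s a b N hs ha hab hb hN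
    rw [card_facesOfCard_left_succ (k := 1) (u := 0) (by omega) (by omega) hs ha hab hb
      (by omega)]
    have h : ∀ x ∈ Finset.Icc 1 a,
        (facesOfCard n ξ (s + 1) x b (2 * 1 + 0 + x + b - 3)).card = if x = 1 then 1 else 0 := by
      intro x hx
      rw [Finset.mem_Icc] at hx
      exact card_facesOfCard_one (by omega) (by omega) (by omega) (by omega) (by omega) (by omega)
    rw [Finset.sum_congr rfl h]
    simp [ha]
  | succ u ih =>
    intro s a b N hs ha hab hb hN
    rw [card_facesOfCard_left_succ (k := 1) (u := u + 1) (by omega) (by omega) hs ha hab hb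
      (by omega)]
    push_cast
    have h : ∀ x ∈ Finset.Icc 1 a,
        ((facesOfCard n ξ (s + 1) x b (2 * 1 + (u + 1) + x + b - 3)).card : ℤ) =
          ((x - 1 + u).choose u : ℤ) := by
      intro x hx
      rw [Finset.mem_Icc] at hx
      exact ih (by omega) (by omega) (by omega) (by omega) (by omega)
    rw [Finset.sum_congr rfl h]
    have e0 := sum_choose_diag u a 0
    simp only [add_zero] at e0
    rw [e0, show a - 1 + (u + 1) = a + u by omega]

/-! ### The Hilbert polynomial of a cone -/

section Hilbert

variable {α : Type*} [DecidableEq α]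

/-- The number of monomials of degree `r` in the variables `insert a F` that are divisible by all
variables in `F`. -/
theorem card_filter_finsuppAntidiag_insert {a : α} {F : Finset α} (ha : a ∉ F) (r : ℕ) :
    (((insert a F).finsuppAntidiag r).filter (fun γ : α →₀ ℕ => F ⊆ γ.support)).card =
      r.choose F.card := by
  rcases lt_or_ge r F.card with h | h
  · rw [Nat.choose_eq_zero_of_lt h, Finset.card_eq_zero, Finset.eq_empty_iff_forall_notMem]
    intro γ hγ
    rw [Finset.mem_filter, Finset.mem_finsuppAntidiag] at hγ
    have h1 : ∑ x ∈ F, 1 ≤ ∑ x ∈ F, γ x := Finset.sum_le_sum fun x hx =>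
      Nat.one_le_iff_ne_zero.2 (Finsupp.mem_support_iff.1 (hγ.2 hx))
    have h2 : ∑ x ∈ F, γ x ≤ ∑ x ∈ insert a F, γ x :=
      Finset.sum_le_sum_of_subset (Finset.subset_insert a F)
    have h3 := hγ.1.1
    simp only [Finset.sum_const, smul_eq_mul, mul_one] at h1
    have h4 : (insert a F).sum γ = ∑ x ∈ insert a F, γ x := rfl
    omega
  -- Dividing by one copy of each variable in `F` leaves an arbitrary monomial of degree `r -
  -- F.card` in `F.card + 1` variables.
  · have hcard : r.choose F.card = ((insert a F).finsuppAntidiag (r - F.card)).card := by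
      rw [Finset.card_finsuppAntidiag_nat_eq_choose, Finset.card_insert_of_notMem ha,
        show F.card + 1 + (r - F.card) - 1 = r by omega, Nat.choose_symm h]
    rw [hcard]
    symm
    have hsum : ∑ x ∈ insert a F, (Finsupp.indicator F (fun _ _ => 1) : α →₀ ℕ) x = F.card := by
      rw [Finset.sum_insert ha, Finsupp.indicator_of_notMem ha, zero_add,
        Finset.sum_congr rfl fun x hx => Finsupp.indicator_of_mem hx (fun _ _ => 1)]
      simp
    refine Finset.card_nbij' (fun δ => δ + Finsupp.indicator F (fun _ _ => 1))
      (fun γ => γ - Finsupp.indicator F (fun _ _ => 1)) ?_ ?_ ?_ ?_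
    · intro δ hδ
      rw [Finset.mem_coe, Finset.mem_finsuppAntidiag] at hδ
      rw [Finset.mem_coe, Finset.mem_filter, Finset.mem_finsuppAntidiag]
      refine ⟨⟨?_, ?_⟩, ?_⟩
      · have := hδ.1
        change ∑ x ∈ insert a F, (δ x + (Finsupp.indicator F (fun _ _ => 1) : α →₀ ℕ) x) = r
        rw [Finset.sum_add_distrib, hsum, this, Nat.sub_add_cancel h]
      · refine Finsupp.support_add.trans (Finset.union_subset hδ.2 ?_)
        exact (Finsupp.support_indicator_subset _ _).trans (Finset.subset_insert a F)
      · intro x hx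
        rw [Finsupp.mem_support_iff, Finsupp.add_apply, Finsupp.indicator_of_mem hx]
        omega
    · intro γ hγ
      rw [Finset.mem_coe, Finset.mem_filter, Finset.mem_finsuppAntidiag] at hγ
      rw [Finset.mem_coe, Finset.mem_finsuppAntidiag]
      refine ⟨?_, Finsupp.support_tsub.trans hγ.1.2⟩
      have h1 : ∑ x ∈ insert a F, (γ - Finsupp.indicator F (fun _ _ => 1) : α →₀ ℕ) x +
          ∑ x ∈ insert a F, (Finsupp.indicator F (fun _ _ => 1) : α →₀ ℕ) x = r := by
        rw [← Finset.sum_add_distrib, ← hγ.1.1]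
        refine Finset.sum_congr rfl fun x _ => ?_
        rw [Finsupp.tsub_apply]
        by_cases hx : x ∈ F
        · have := Finsupp.mem_support_iff.1 (hγ.2 hx)
          rw [Finsupp.indicator_of_mem hx]
          omega
        · rw [Finsupp.indicator_of_notMem hx]
          omega
      change ∑ x ∈ insert a F, (γ - Finsupp.indicator F (fun _ _ => 1) : α →₀ ℕ) x = r - F.card
      omega
    · intro δ _
      exact add_tsub_cancel_right _ _
    · intro γ hγ
      rw [Finset.mem_coe, Finset.mem_filter] at hγ
      refine tsub_add_cancel_of_le fun x => ?_
      by_cases hx : x ∈ F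
      · rw [Finsupp.indicator_of_mem hx]
        exact Nat.one_le_iff_ne_zero.2 (Finsupp.mem_support_iff.1 (hγ.2 hx))
      · rw [Finsupp.indicator_of_notMem hx]
        exact Nat.zero_le _

theorem Polynomial.eval_natCast_descPochhammer_div (k r : ℕ) :
    (Polynomial.C ((k.factorial : ℚ)⁻¹) * descPochhammer ℚ k).eval (r : ℚ) = r.choose k := by
  rw [Polynomial.eval_mul, Polynomial.eval_C, descPochhammer_eval_eq_descFactorial,
    Nat.descFactorial_eq_factorial_mul_choose, Nat.cast_mul, inv_mul_cancel_left₀]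
  exact_mod_cast k.factorial_ne_zero

/-- The number of monomials of degree `r` whose support is a face of a complex with a cone point is
a polynomial in `r`, and its normalized leading coefficient is the number of faces of maximal
cardinality. -/
theorem exists_hilbertPolynomial (V : Finset α) (Face : Finset α → Prop)
    (hV : ∀ F, Face F → F ⊆ V) (a : α) (hcone : ∀ F, Face (insert a F) ↔ Face F) (d : ℕ)
    (hd : ∀ F, Face F → F.card ≤ d) (T : Finset (Finset α))
    (hT : ∀ F, F ∈ T ↔ Face F ∧ F.card = d) (hT0 : T.Nonempty) :
    ∃ p : Polynomial ℚ, (∀ r : ℕ, p.eval (r : ℚ) =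
        (({γ : α →₀ ℕ | Face γ.support ∧ ∑ x ∈ γ.support, γ x = r}).ncard : ℚ)) ∧
      p.leadingCoeff * (p.natDegree.factorial : ℚ) = T.card := by
  classical
  -- A face of maximal size contains the cone point, since otherwise adding it would give a larger
  -- face.
  have hmem : ∀ F ∈ T, a ∈ F := by
    intro F hF
    by_contra haF
    rw [hT] at hF
    have := hd _ ((hcone F).2 hF.1)
    rw [Finset.card_insert_of_notMem haF] at this
    omega
  obtain ⟨e, rfl⟩ : ∃ e, d = e + 1 := by
    obtain ⟨F, hF⟩ := hT0
    have h1 := Finset.card_pos.2 ⟨a, hmem F hF⟩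
    rw [hT] at hF
    exact ⟨d - 1, by omega⟩
  -- `B` is the base of the cone. Its faces have size at most `e = d - 1`, and those of size `e`
  -- correspond to the faces of size `d`.
  set B : Finset (Finset α) := V.powerset.filter (fun F => Face F ∧ a ∉ F) with hBdef
  have hB : ∀ F, F ∈ B ↔ Face F ∧ a ∉ F := by
    intro F
    rw [hBdef, Finset.mem_filter, Finset.mem_powerset]
    exact ⟨fun h => h.2, fun h => ⟨hV F h.1, h⟩⟩
  have hBcard : ∀ F ∈ B, F.card ≤ e := by
    intro F hF
    rw [hB] at hF
    have := hd _ ((hcone F).2 hF.1)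
    rw [Finset.card_insert_of_notMem hF.2] at this
    omega
  have hTB : T.card = (B.filter (fun F => F.card = e)).card := by
    refine Finset.card_nbij' (fun F => F.erase a) (fun F => insert a F) ?_ ?_ ?_ ?_
    · intro F hF
      rw [Finset.mem_coe] at hF
      have h1 := hmem F hF
      rw [hT] at hF
      rw [Finset.mem_coe, Finset.mem_filter, hB, ← hcone, Finset.insert_erase h1,
        Finset.card_erase_of_mem h1]
      exact ⟨⟨hF.1, Finset.notMem_erase a F⟩, by omega⟩
    · intro F hF
      rw [Finset.mem_coe, Finset.mem_filter, hB] at hF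
      rw [Finset.mem_coe, hT, hcone, Finset.card_insert_of_notMem hF.1.2]
      exact ⟨hF.1.1, by omega⟩
    · intro F hF
      exact Finset.insert_erase (hmem F hF)
    · intro F hF
      rw [Finset.mem_coe, Finset.mem_filter, hB] at hF
      exact Finset.erase_insert hF.1.2
  set p : Polynomial ℚ :=
    ∑ F ∈ B, Polynomial.C ((F.card.factorial : ℚ)⁻¹) * descPochhammer ℚ F.card with hp
  have hnat : ∀ k : ℕ, (descPochhammer ℚ k).natDegree = k := fun k => by
    exact descPochhammer_natDegree ℚ k
  have hdeg : p.natDegree ≤ e := by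
    refine Polynomial.natDegree_sum_le_of_forall_le _ _ fun F hF => ?_
    refine (Polynomial.natDegree_C_mul_le _ _).trans ?_
    rw [hnat]
    exact hBcard F hF
  have hcoeff : p.coeff e = T.card * (e.factorial : ℚ)⁻¹ := by
    rw [hp, Polynomial.finsetSum_coeff, hTB, Finset.card_filter, Nat.cast_sum, Finset.sum_mul]
    refine Finset.sum_congr rfl fun F hF => ?_
    rw [Polynomial.coeff_C_mul]
    split_ifs with h
    · have := (monic_descPochhammer ℚ F.card).coeff_natDegree
      rw [hnat] at this
      rw [← h, this]
      simp
    · rw [Polynomial.coeff_eq_zero_of_natDegree_lt]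
      · simp
      · rw [hnat]
        exact lt_of_le_of_ne (hBcard F hF) h
  have he : (e.factorial : ℚ) ≠ 0 := by exact_mod_cast e.factorial_ne_zero
  have hne : p.coeff e ≠ 0 := by
    rw [hcoeff]
    refine mul_ne_zero ?_ (inv_ne_zero he)
    exact_mod_cast (Finset.card_pos.2 hT0).ne'
  have hdeg' : p.natDegree = e := le_antisymm hdeg (Polynomial.le_natDegree_of_ne_zero hne)
  refine ⟨p, fun r => ?_, ?_⟩
  · have hset : {γ : α →₀ ℕ | Face γ.support ∧ ∑ x ∈ γ.support, γ x = r} =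
        (B.biUnion (fun F => ((insert a F).finsuppAntidiag r).filter
          (fun γ : α →₀ ℕ => F ⊆ γ.support)) : Finset (α →₀ ℕ)) := by
      ext γ
      have hins : insert a (γ.support.erase a) = insert a γ.support := by grind
      rw [Set.mem_ofPred_eq, Finset.mem_coe, Finset.mem_biUnion]
      constructor
      · rintro ⟨h1, h2⟩
        refine ⟨γ.support.erase a, ?_, ?_⟩
        · rw [hB, ← hcone, hins, hcone]
          exact ⟨h1, Finset.notMem_erase _ _⟩
        · have h3 : γ.support ⊆ insert a (γ.support.erase a) := by
            rw [hins]; exact Finset.subset_insert _ _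
          rw [Finset.mem_filter, Finset.mem_finsuppAntidiag]
          refine ⟨⟨?_, h3⟩, Finset.erase_subset _ _⟩
          rw [← h2]
          exact (Finset.sum_subset h3 fun x _ hx => Finsupp.notMem_support_iff.1 hx).symm
      · rintro ⟨F, hF, hγ⟩
        rw [Finset.mem_filter, Finset.mem_finsuppAntidiag] at hγ
        rw [hB] at hF
        refine ⟨?_, ?_⟩
        · rw [← hcone, show insert a γ.support = insert a F from subset_antisymm
            (Finset.insert_subset (Finset.mem_insert_self _ _) hγ.1.2)
            (Finset.insert_subset_insert _ hγ.2), hcone]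
          exact hF.1
        · rw [← hγ.1.1]
          exact Finset.sum_subset hγ.1.2 fun x _ hx => Finsupp.notMem_support_iff.1 hx
    rw [hset, Set.ncard_coe_finset, Finset.card_biUnion, hp, Polynomial.eval_finsetSum,
      Nat.cast_sum]
    · refine Finset.sum_congr rfl fun F hF => ?_
      rw [card_filter_finsuppAntidiag_insert ((hB F).1 hF).2,
        Polynomial.eval_natCast_descPochhammer_div]
    -- The base face is recovered from a monomial by deleting the cone point from its support, so
    -- the classes are disjoint.
    · have key : ∀ F ∈ B, ∀ γ : α →₀ ℕ, γ ∈ ((insert a F).finsuppAntidiag r).filter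
          (fun γ : α →₀ ℕ => F ⊆ γ.support) → γ.support.erase a = F := by
        intro F hF γ hγ
        rw [Finset.mem_filter, Finset.mem_finsuppAntidiag] at hγ
        rw [hB] at hF
        refine subset_antisymm ?_ ?_
        · rw [← Finset.subset_insert_iff]
          exact hγ.1.2
        · intro x hx
          rw [Finset.mem_erase]
          exact ⟨fun h => hF.2 (h ▸ hx), hγ.2 hx⟩
      intro F hF G hG hne
      rw [Function.onFun, Finset.disjoint_left]
      intro γ h1 h2
      exact hne ((key F hF γ h1).symm.trans (key G hG γ h2))
  · rw [Polynomial.leadingCoeff, hdeg', hcoeff, inv_mul_cancel_right₀ he]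

end Hilbert

/-! ### Application to the two counting functions -/

section Main

variable {m n ρ ξ : ℕ}

/-- The corner has the least row and the greatest column, so it belongs to no 2-chain. It satisfies
`left` because `1 ≤ ρ`. -/
theorem isFace_insert_corner {F : Finset (ℕ × ℕ)} (hm : 1 ≤ m) (hn : 1 ≤ n) (hρ : 1 ≤ ρ) :
    IsFace n ξ 1 ρ m (insert (1, n) F) ↔ IsFace n ξ 1 ρ m F := by
  constructor
  · intro h
    have hi : ∀ p ∈ F, p ∈ insert (1, n) F := fun p hp => Finset.mem_insert_of_mem hp
    exact ⟨fun p hp => h.row p (hi p hp), fun p hp => h.col p (hi p hp),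
      fun p hp => h.left p (hi p hp),
      fun p hp q hq r hr => h.three p (hi p hp) q (hi q hq) r (hi r hr),
      fun p hp q hq => h.twoLeft p (hi p hp) q (hi q hq),
      fun p hp q hq => h.twoBelow p (hi p hp) q (hi q hq)⟩
  · intro h
    have hlow : ∀ p ∈ insert (1, n) F, ∀ q ∈ insert (1, n) F, p.1 < q.1 → p.2 < q.2 →
        p ∈ F ∧ q ∈ F := by
      intro p hp q hq h1 h2
      rw [Finset.mem_insert] at hp hq
      rcases hp with rfl | hp <;> rcases hq with rfl | hq
      · simp at h1
      · have := h.col q hq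
        simp at h2; omega
      · have := h.row p hp
        simp at h1; omega
      · exact ⟨hp, hq⟩
    refine ⟨?_, ?_, ?_, ?_, ?_, ?_⟩
    · intro p hp
      rw [Finset.mem_insert] at hp
      rcases hp with rfl | hp
      · exact ⟨le_rfl, hm⟩
      · exact h.row p hp
    · intro p hp
      rw [Finset.mem_insert] at hp
      rcases hp with rfl | hp
      · exact ⟨hn, le_rfl⟩
      · exact h.col p hp
    · intro p hp
      rw [Finset.mem_insert] at hp
      rcases hp with rfl | hp
      · exact Or.inl hρ
      · exact h.left p hp
    · intro p hp q hq r hr h1 h2 h3 h4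
      exact h.three p (hlow p hp q hq h1 h2).1 q (hlow p hp q hq h1 h2).2 r
        (hlow q hq r hr h3 h4).2 h1 h2 h3 h4
    · intro p hp q hq h1 h2
      exact h.twoLeft p (hlow p hp q hq h1 h2).1 q (hlow p hp q hq h1 h2).2 h1 h2
    · intro p hp q hq h1 h2
      exact h.twoBelow p (hlow p hp q hq h1 h2).1 q (hlow p hp q hq h1 h2).2 h1 h2

theorem S2_eq_isFace (r : ℕ) : S2 m n ρ ξ r =
    {γ | IsFace n ξ 1 ρ m γ.support ∧ ∑ x ∈ γ.support, γ x = r} := by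
  ext γ
  constructor
  · rintro ⟨⟨h1, h2⟩, h3, h4, h5, h6⟩
    refine ⟨⟨fun p hp => (h1 p hp).1, fun p hp => (h1 p hp).2, h3, ?_, ?_, ?_⟩, h2⟩
    · intro p hp q hq r hr a b c d
      exact h4 ⟨p, hp, q, hq, r, hr, ⟨a, b⟩, c, d⟩
    · intro p hp q hq a b
      by_contra! hlt
      exact h5 ⟨p, ⟨hp, by omega⟩, q, ⟨hq, hlt⟩, a, b⟩
    · intro p hp q hq a b
      by_contra! hlt
      exact h6 ⟨p, ⟨hp, hlt⟩, q, ⟨hq, by omega⟩, a, b⟩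
  · rintro ⟨h, h2⟩
    refine ⟨⟨fun p hp => ⟨h.row p hp, h.col p hp⟩, h2⟩, h.left, ?_, ?_, ?_⟩
    · rintro ⟨p, hp, q, hq, r, hr, ⟨a, b⟩, c, d⟩
      exact h.three p hp q hq r hr a b c d
    · rintro ⟨p, ⟨hp, -⟩, q, ⟨hq, hlt⟩, a, b⟩
      have := h.twoLeft p hp q hq a b
      omega
    · rintro ⟨p, ⟨hp, hlt⟩, q, ⟨hq, -⟩, a, b⟩
      have := h.twoBelow p hp q hq a b
      omega

/-- For `ρ = m` no row lies beyond `ρ`, so the extra conditions in `S2` are vacuous. -/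
theorem S1_eq_S2 (r : ℕ) : S1 m n ξ r = S2 m n m ξ r := by
  ext γ
  constructor
  · rintro ⟨h1, h2, h3⟩
    refine ⟨h1, fun a ha => Or.inl (h1.1 a ha).1.2, h2, h3, ?_⟩
    rintro ⟨p, ⟨hp, hlt⟩, -⟩
    have := (h1.1 p hp).1.2
    omega
  · rintro ⟨h1, -, h2, h3, -⟩
    exact ⟨h1, h2, h3⟩

/-- A single column contains no 2-chain. -/
theorem S2_one_eq_two (r : ℕ) : S2 m n m 1 r = S2 m n m 2 r := by
  rw [← S1_eq_S2, ← S1_eq_S2]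
  ext γ
  constructor
  · rintro ⟨h1, h2, -⟩
    refine ⟨h1, h2, ?_⟩
    rintro ⟨p, ⟨hp, -⟩, q, ⟨hq, hlt⟩, a, b⟩
    have := (h1.1 p hp).2
    have := (h1.1 q hq).2
    omega
  · rintro ⟨h1, h2, -⟩
    refine ⟨h1, h2, ?_⟩
    rintro ⟨p, ⟨hp, hlt⟩, -⟩
    have := (h1.1 p hp).2
    omega

theorem exists_polynomial_P2 (hm : 1 ≤ m) (hn : 1 ≤ n) (hρ : 1 ≤ ρ) (d c : ℕ)
    (hd : ∀ F, IsFace n ξ 1 ρ m F → F.card ≤ d) (hc : (facesOfCard n ξ 1 ρ m d).card = c)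
    (hc0 : 0 < c) :
    ∃ p : Polynomial ℚ, (∀ r : ℕ, p.eval (r : ℚ) = (P2 m n ρ ξ r : ℚ)) ∧
      p.leadingCoeff * (p.natDegree.factorial : ℚ) = c := by
  obtain ⟨p, h1, h2⟩ := exists_hilbertPolynomial (Finset.Icc 1 m ×ˢ Finset.Icc 1 n)
    (IsFace n ξ 1 ρ m) (fun F hF p hp => by
      simp only [Finset.mem_product, Finset.mem_Icc]
      exact ⟨hF.row p hp, hF.col p hp⟩) (1, n)
    (fun F => isFace_insert_corner hm hn hρ) d hd (facesOfCard n ξ 1 ρ m d)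
    (fun F => mem_facesOfCard) (Finset.card_pos.1 (hc ▸ hc0))
  refine ⟨p, fun r => ?_, by rw [h2, hc]⟩
  rw [h1, P2, S2_eq_isFace]

/-- With only one row or column, there are no chains at all. -/
theorem exists_polynomial_P2_of_eq_one (hρ : 1 ≤ ρ) (hρm : ρ ≤ m) (hξ : 1 ≤ ξ) (hξn : ξ ≤ n)
    (h : m = 1 ∨ n = 1) :
    ∃ p : Polynomial ℚ, (∀ r : ℕ, p.eval (r : ℚ) = (P2 m n ρ ξ r : ℚ)) ∧
      p.leadingCoeff * (p.natDegree.factorial : ℚ) = 1 := by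
  have hsub : ∀ F, IsFace n ξ 1 ρ m F → F ⊆ Finset.Icc 1 m ×ˢ Finset.Icc 1 n := by
    intro F hF p hp
    simp only [Finset.mem_product, Finset.mem_Icc]
    exact ⟨hF.row p hp, hF.col p hp⟩
  have key := exists_polynomial_P2 (by omega) (by omega) hρ
    (Finset.Icc 1 m ×ˢ Finset.Icc 1 n).card 1 (fun F hF => Finset.card_le_card (hsub F hF)) ?_
    one_pos
  · simpa using key
  · rw [Finset.card_eq_one]
    refine ⟨Finset.Icc 1 m ×ˢ Finset.Icc 1 n, ?_⟩
    ext F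
    rw [mem_facesOfCard, Finset.mem_singleton]
    constructor
    · rintro ⟨h1, h2⟩
      exact Finset.eq_of_subset_of_card_le (hsub F h1) h2.ge
    · rintro rfl
      refine ⟨⟨?_, ?_, ?_, ?_, ?_, ?_⟩, rfl⟩ <;>
        simp only [Finset.mem_product, Finset.mem_Icc] <;> intros <;> omega

/-- For `ξ < n` this is the determinant after reflecting the binomials in `m`. For `ξ = n` the
second product vanishes and the first reduces to the single-path count. -/
theorem card_topFaces (hm : 2 ≤ m) (hρ : 1 ≤ ρ) (hρm : ρ ≤ m) (hn : 2 ≤ n) (hξ : 1 ≤ ξ)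
    (hξn : ξ ≤ n) :
    ((facesOfCard n ξ 1 ρ m (2 * (n + 1 - ξ) + (ξ - 1) + ρ + m - 3)).card : ℤ) =
      ((ρ + n - 3).choose (n - 2) : ℤ) * ((m + n - ξ - 2).choose (m - 2) : ℤ) -
        ((ρ + n - 3).choose (n - 1) : ℤ) * ((m + n - ξ - 2).choose (m - 1) : ℤ) := by
  rcases hξn.lt_or_eq with h | rfl
  · obtain ⟨i, rfl⟩ : ∃ i, n = ξ + i + 1 := ⟨n - ξ - 1, by omega⟩
    obtain ⟨u, rfl⟩ : ∃ u, ξ = u + 1 := ⟨ξ - 1, by omega⟩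
    rw [card_facesOfCard_left_add_two rfl u (by omega) hρ hρm hm (by omega),
      show m + (u + 1 + i + 1) - (u + 1) - 2 = m - 1 + i by omega,
      show ρ + (u + 1 + i + 1) - 3 = ρ - 1 + (i + u) by omega,
      show u + 1 + i + 1 - 2 = i + u by omega, show u + 1 + i + 1 - 1 = i + u + 1 by omega,
      ← Nat.choose_symm_of_eq_add (show m - 1 + i = (m - 2) + (i + 1) by omega),
      ← Nat.choose_symm_of_eq_add (show m - 1 + i = (m - 1) + i by omega)]
  · obtain ⟨u, rfl⟩ : ∃ u, ξ = u + 2 := ⟨ξ - 2, by omega⟩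
    rw [card_facesOfCard_left_last rfl u (by omega) hρ hρm hm (by omega),
      show m + (u + 2) - (u + 2) - 2 = m - 2 by omega, Nat.choose_self,
      Nat.choose_eq_zero_of_lt (show m - 2 < m - 1 by omega),
      show ρ + (u + 2) - 3 = ρ - 1 + u by omega, show u + 2 - 2 = u by omega]
    simp

/-- Each binomial in the second product is a rational multiple of its neighbour in the first, so the
common product factors out. -/
theorem choose_sub_choose_eq (hm : 2 ≤ m) (hρ : 1 ≤ ρ) (hn : 2 ≤ n) (hξn : ξ ≤ n) :
    (((ρ + n - 3).choose (n - 2) : ℚ) * ((m + n - ξ - 2).choose (m - 2) : ℚ) -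
        ((ρ + n - 3).choose (n - 1) : ℚ) * ((m + n - ξ - 2).choose (m - 1) : ℚ)) =
      (((m : ℚ) - ρ) * ((n : ℚ) - 1) + ((ρ : ℚ) - 1) * ((ξ : ℚ) - 1)) /
              (((m : ℚ) - 1) * ((n : ℚ) - 1)) *
            ((m + n - ξ - 2).choose (m - 2) : ℚ) * ((ρ + n - 3).choose (n - 2) : ℚ) := by
  obtain ⟨m, rfl⟩ : ∃ k, m = k + 2 := ⟨m - 2, by omega⟩
  obtain ⟨k, rfl⟩ : ∃ k, n = ξ + k := ⟨n - ξ, by omega⟩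
  obtain ⟨l, hl⟩ : ∃ l, ξ + k = l + 2 := ⟨ξ + k - 2, by omega⟩
  obtain ⟨ρ, rfl⟩ : ∃ k, ρ = k + 1 := ⟨ρ - 1, by omega⟩
  rw [show m + 2 + (ξ + k) - ξ - 2 = m + k by omega, show ρ + 1 + (ξ + k) - 3 = ρ + l by omega,
    show ξ + k - 2 = l by omega, show ξ + k - 1 = l + 1 by omega, show m + 2 - 2 = m by omega,
    show m + 2 - 1 = m + 1 by omega]
  have e1 := Nat.choose_succ_right_eq (ρ + l) l
  have e2 := Nat.choose_succ_right_eq (m + k) m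
  rw [Nat.add_sub_cancel] at e1
  rw [Nat.add_sub_cancel_left] at e2
  have f1 : ((ρ + l).choose (l + 1) : ℚ) = (ρ + l).choose l * ρ / (l + 1) := by
    rw [eq_div_iff (by positivity)]; exact_mod_cast e1
  have f2 : ((m + k).choose (m + 1) : ℚ) = (m + k).choose m * k / (m + 1) := by
    rw [eq_div_iff (by positivity)]; exact_mod_cast e2
  have hξ' : (ξ : ℚ) = l + 2 - k := by
    have : (ξ : ℚ) + k = l + 2 := by exact_mod_cast hl
    linarith
  rw [f1, f2]
  push_cast
  rw [hξ', show (m : ℚ) + 2 - 1 = m + 1 by ring,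
    show (l : ℚ) + 2 - k + k - 1 = l + 1 by ring]
  field_simp
  ring

theorem exists_polynomial_P2_of_two_le (hm : 2 ≤ m) (hρ : 1 ≤ ρ) (hρm : ρ ≤ m) (hn : 2 ≤ n)
    (hξ : 1 ≤ ξ) (hξn : ξ ≤ n) (h : ρ < m ∨ 2 ≤ ξ) :
    ∃ p : Polynomial ℚ, (∀ r : ℕ, p.eval (r : ℚ) = (P2 m n ρ ξ r : ℚ)) ∧
      p.leadingCoeff * (p.natDegree.factorial : ℚ) =
          (((m : ℚ) - ρ) * ((n : ℚ) - 1) + ((ρ : ℚ) - 1) * ((ξ : ℚ) - 1)) /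
              (((m : ℚ) - 1) * ((n : ℚ) - 1)) *
            ((m + n - ξ - 2).choose (m - 2) : ℚ) * ((ρ + n - 3).choose (n - 2) : ℚ) := by
  have hm' : (2 : ℚ) ≤ m := by exact_mod_cast hm
  have hn' : (2 : ℚ) ≤ n := by exact_mod_cast hn
  have hρ' : (1 : ℚ) ≤ ρ := by exact_mod_cast hρ
  have hξ' : (1 : ℚ) ≤ ξ := by exact_mod_cast hξ
  have hρm' : (ρ : ℚ) ≤ m := by exact_mod_cast hρm
  have hcard : ((facesOfCard n ξ 1 ρ m (2 * (n + 1 - ξ) + (ξ - 1) + ρ + m - 3)).card : ℚ) =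
      (((m : ℚ) - ρ) * ((n : ℚ) - 1) + ((ρ : ℚ) - 1) * ((ξ : ℚ) - 1)) /
              (((m : ℚ) - 1) * ((n : ℚ) - 1)) *
            ((m + n - ξ - 2).choose (m - 2) : ℚ) * ((ρ + n - 3).choose (n - 2) : ℚ) := by
    rw [← choose_sub_choose_eq hm hρ hn hξn]
    exact_mod_cast card_topFaces hm hρ hρm hn hξ hξn
  rw [← hcard]
  refine exists_polynomial_P2 (by omega) (by omega) hρ _ _ ?_ rfl ?_
  · intro F hF
    have := hF.card_le_left (k := n + 1 - ξ) (by omega) (ξ - 1) (by omega) hρ hρm hm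
    omega
  -- Positivity shows that the size bound is attained. This is where the case `ρ = m`, `ξ = 1` has
  -- to be excluded.
  · have hpos : (0 : ℚ) < ((m : ℚ) - ρ) * ((n : ℚ) - 1) + ((ρ : ℚ) - 1) * ((ξ : ℚ) - 1) := by
      rcases hρm.lt_or_eq with h1 | rfl
      · have h1' : (ρ : ℚ) < m := by exact_mod_cast h1
        have := mul_pos (sub_pos.2 h1') (show (0 : ℚ) < n - 1 by linarith)
        have := mul_nonneg (sub_nonneg.2 hρ') (sub_nonneg.2 hξ')
        linarith
      · have h2 : (2 : ℚ) ≤ ξ := by exact_mod_cast h.resolve_left (lt_irrefl _)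
        have := mul_pos (show (0 : ℚ) < ρ - 1 by linarith) (show (0 : ℚ) < ξ - 1 by linarith)
        linarith
    have c1 : (0 : ℚ) < (m + n - ξ - 2).choose (m - 2) := by
      exact_mod_cast Nat.choose_pos (by omega)
    have c2 : (0 : ℚ) < (ρ + n - 3).choose (n - 2) := by
      exact_mod_cast Nat.choose_pos (by omega)
    have hden := mul_pos (show (0 : ℚ) < m - 1 by linarith) (show (0 : ℚ) < n - 1 by linarith)
    have := mul_pos (mul_pos (div_pos hpos hden) c1) c2
    rw [← hcard] at this
    exact_mod_cast this

end Main

theorem exists_polynomial_P2_eq (m n ρ ξ : ℕ) (hρ : 1 ≤ ρ) (hρm : ρ ≤ m) (hξ : 1 ≤ ξ)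
    (hξn : ξ ≤ n) :
    ∃ p : Polynomial ℚ, (∀ r : ℕ, p.eval (r : ℚ) = (P2 m n ρ ξ r : ℚ)) ∧
      p.leadingCoeff * (p.natDegree.factorial : ℚ) =
        if m = 1 ∨ n = 1 then 1
        else if m = ρ ∧ ξ = 1 then
          1 / ((n : ℚ) - 1) * ((m + n - 4).choose (m - 2) : ℚ) * ((m + n - 3).choose (n - 2) : ℚ)
        else
          (((m : ℚ) - ρ) * ((n : ℚ) - 1) + ((ρ : ℚ) - 1) * ((ξ : ℚ) - 1)) /
              (((m : ℚ) - 1) * ((n : ℚ) - 1)) *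
            ((m + n - ξ - 2).choose (m - 2) : ℚ) * ((ρ + n - 3).choose (n - 2) : ℚ) := by
  split_ifs with h1 h2
  · exact exists_polynomial_P2_of_eq_one hρ hρm hξ hξn h1
  -- Here the determinant vanishes, so the count is taken from `ξ = 2`, which gives the same set of
  -- monomials.
  · obtain ⟨rfl, rfl⟩ := h2
    obtain ⟨p, hp, hlc⟩ := exists_polynomial_P2_of_two_le (m := m) (n := n) (ρ := m) (ξ := 2)
      (by omega) hρ hρm (by omega) (by omega) (by omega) (Or.inr le_rfl)
    refine ⟨p, fun r => by rw [hp, P2, P2, S2_one_eq_two], ?_⟩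
    have hm' : (m : ℚ) - 1 ≠ 0 := sub_ne_zero.2 (by exact_mod_cast (by omega : m ≠ 1))
    have hn' : (n : ℚ) - 1 ≠ 0 := sub_ne_zero.2 (by exact_mod_cast (by omega : n ≠ 1))
    rw [hlc, show m + n - 2 - 2 = m + n - 4 by omega]
    push_cast
    field_simp
    ring
  · exact exists_polynomial_P2_of_two_le (by omega) hρ hρm (by omega) hξ hξn (by omega)

theorem mainTheorem10 (m n ρ ξ : ℕ) (hρ : 1 ≤ ρ) (hρm : ρ ≤ m) (hξ : 1 ≤ ξ) (hξn : ξ ≤ n) :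
    (∃ p : Polynomial ℚ, (∀ r : ℕ, p.eval (r : ℚ) = (P1 m n ξ r : ℚ)) ∧
      p.leadingCoeff * (p.natDegree.factorial : ℚ) =
        if m = 1 ∨ n < 3 then 1
        else if ξ = 1 then
          1 / ((n : ℚ) - 1) * ((m + n - 4).choose (m - 2) : ℚ) * ((m + n - 3).choose (n - 2) : ℚ)
        else
          ((ξ : ℚ) - 1) / ((n : ℚ) - 1) * ((m + n - ξ - 2).choose (m - 2) : ℚ) *
            ((m + n - 3).choose (n - 2) : ℚ)) ∧
    (∃ p : Polynomial ℚ, (∀ r : ℕ, p.eval (r : ℚ) = (P2 m n ρ ξ r : ℚ)) ∧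
      p.leadingCoeff * (p.natDegree.factorial : ℚ) =
        if m = 1 ∨ n = 1 then 1
        else if m = ρ ∧ ξ = 1 then
          1 / ((n : ℚ) - 1) * ((m + n - 4).choose (m - 2) : ℚ) * ((m + n - 3).choose (n - 2) : ℚ)
        else
          (((m : ℚ) - ρ) * ((n : ℚ) - 1) + ((ρ : ℚ) - 1) * ((ξ : ℚ) - 1)) /
              (((m : ℚ) - 1) * ((n : ℚ) - 1)) *
            ((m + n - ξ - 2).choose (m - 2) : ℚ) * ((ρ + n - 3).choose (n - 2) : ℚ)) := by
  refine ⟨?_, exists_polynomial_P2_eq m n ρ ξ hρ hρm hξ hξn⟩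
  obtain ⟨p, hp, hlc⟩ := exists_polynomial_P2_eq m n m ξ (hρ.trans hρm) le_rfl hξ hξn
  refine ⟨p, fun r => by rw [hp, P1, P2, S1_eq_S2], ?_⟩
  rw [hlc]
  by_cases h1 : m = 1 ∨ n = 1
  · rw [if_pos h1, if_pos (by omega)]
  have hm' : (m : ℚ) - 1 ≠ 0 := sub_ne_zero.2 (by exact_mod_cast (by omega : m ≠ 1))
  have hn' : (n : ℚ) - 1 ≠ 0 := sub_ne_zero.2 (by exact_mod_cast (by omega : n ≠ 1))
  rw [if_neg h1]
  -- For `n = 2` both formulas for `P2` with `ρ = m` evaluate to `1`, which is why the first case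
  -- for `P1` reads `n < 3`.
  by_cases h2 : n = 2
  · subst h2
    rw [if_pos (Or.inr (by norm_num)), show m + 2 - 4 = m - 2 by omega]
    split_ifs with h3
    · norm_num
    · obtain rfl : ξ = 2 := by omega
      rw [show m + 2 - 2 - 2 = m - 2 by omega]
      push_cast
      simp only [Nat.choose_self, Nat.choose_zero_right]
      field_simp
      ring
  · rw [if_neg (show ¬ (m = 1 ∨ n < 3) by omega)]
    simp only [true_and]
    split_ifs with h3
    · rfl
    · field_simp
      ring
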